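/- Definitions. Let $X_d=\{0,1\}^d$ and let $C$ be a nonempty concept class over $X_d$, i.e. a set of functions $X_d\to\{0,1\}$; $\mathrm{VC}(C)$ is its VC dimension. A learner is a randomized algorithm $A$ that maps databases in $(X_d\times\{0,1,\bot\})^n$ to hypotheses $h:X_d\to\{0,1\}$. It is *proper* for $C$ if on every input it outputs only elements of $C$. It is (pure) *$\epsilon$-differentially private* if for all databases $S,S'$ differing in exactly one entry and all sets $F$ of hypotheses, $\Pr[A(S)\in F]\le e^{\epsilon}\Pr[A(S')\in F]$. For $m\le n$, it is an *$(\alpha,\beta,n,m)$-semi-supervised learner* for $C$ if for every target $c\in C$ and every probability distribution $\mu$ on $X_d$, when $x_1,\dots,x_n$ are drawn i.i.d. from $\mu$, the first $m$ of them are labeled by $c(x_i)$ and the remaining $n-m$ are labeled by $\bot$, the probability (over the sample and the coins of $A$) that $A$ outputs an $h$ with $\Pr_{x\sim\mu}[h(x)\ne c(x)]>\alpha$ is at most $\beta$. Theorem. For all $\alpha_0<1$ and $\epsilon_0$ there is a constant $K$, depending only on $\alpha_0$ and $\epsilon_0$, such that for every $d$, every nonempty concept class $C$ over $X_d$, and all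 $0<\alpha\le\alpha_0$, $0<\beta<1$ and $0<\epsilon\le\epsilon_0$, there are integers $m\le n$ with $$m\le K\left(\frac{\mathrm{VC}(C)}{\alpha^3\epsilon}\log\frac1\alpha+\frac{1}{\alpha\epsilon}\log\frac1\beta\right),\qquad n\le K\left(\frac{d\cdot\mathrm{VC}(C)}{\alpha^3\epsilon}\log\frac1\alpha+\frac{1}{\alpha\epsilon}\log\frac1\beta\right)$$ and an $\epsilon$-differentially private proper $(\alpha,\beta,n,m)$-semi-supervised learner for $C$. (No efficiency of the learner is claimed.) -/

import Mathlib

open scoped ENNReal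

/-- The domain `X_d = {0,1}^d`. -/
abbrev Cube (d : ℕ) : Type := Fin d → Bool

/-- The VC dimension of a class `C` of concepts `X → {0,1}` over a finite domain `X`: the largest
cardinality of a shattered set, where concepts are identified with the subsets they indicate. -/
noncomputable def conceptVCDim {X : Type*} [Fintype X] [DecidableEq X] (C : Set (X → Bool)) : ℕ :=
  open Classical in
  (Finset.univ.filter fun B : Finset X => (fun x => decide (x ∈ B)) ∈ C).vcDim

/-- Databases with `n` entries, each entry being an example together with a label in
`{0, 1, ⊥}` (`none` is `⊥`). -/
abbrev PartialDatabase (X : Type*) (n : ℕ) : Type _ := Fin n → X × Option Bool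

/-- A randomized algorithm mapping databases with `n` entries to hypotheses, given by its output
distributions. -/
abbrev LearningAlgorithm (X : Type*) (n : ℕ) : Type _ := PartialDatabase X n → PMF (X → Bool)

/-- Two databases are neighboring if they differ in exactly one entry. -/
def Neighboring {E : Type*} {n : ℕ} (D D' : Fin n → E) : Prop :=
  ∃! i, D i ≠ D' i

/-- `(ε, δ)`-differential privacy of a randomized algorithm on databases with `n` entries in `E`. -/
def IsDifferentiallyPrivate {E O : Type*} {n : ℕ} (ε δ : ℝ) (A : (Fin n → E) → PMF O) : Prop :=
  ∀ D D' : Fin n → E, Neighboring D D' → ∀ F : Set O,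
    (A D).toOuterMeasure F
      ≤ ENNReal.ofReal (Real.exp ε) * (A D').toOuterMeasure F + ENNReal.ofReal δ

/-- The generalization error `Pr_{x ∼ μ}[h x ≠ c x]`. -/
noncomputable def genError {X : Type*} (μ : PMF X) (c h : X → Bool) : ℝ :=
  (μ.toOuterMeasure {x | h x ≠ c x}).toReal

/-- The database with examples `x`, in which the first `m` entries are labeled by `c` and the
remaining ones are unlabeled. -/
def labelFirst {X : Type*} {n : ℕ} (c : X → Bool) (m : ℕ) (x : Fin n → X) : PartialDatabase X n :=
  fun i => (x i, if (i : ℕ) < m then some (c (x i)) else none)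

/-- The probability that `A` returns a hypothesis of generalization error more than `α`, over `n`
examples drawn i.i.d. from `μ`, the first `m` of them labeled by `c`, and over the coins of `A`. -/
noncomputable def failureProb {X : Type*} [Fintype X] {n : ℕ} (A : LearningAlgorithm X n)
    (μ : PMF X) (c : X → Bool) (α : ℝ) (m : ℕ) : ℝ≥0∞ :=
  ∑ x : Fin n → X, (∏ i, μ (x i)) * (A (labelFirst c m x)).toOuterMeasure {h | α < genError μ c h}

/-- `(α, β, n, m)`-semi-supervised learner for the concept class `C`, where `n` is the total number
of examples and `m` is the number of labeled ones. -/
def IsSSL {X : Type*} [Fintype X] {n : ℕ} (α β : ℝ) (m : ℕ) (C : Set (X → Bool))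
    (A : LearningAlgorithm X n) : Prop :=
  m ≤ n ∧ ∀ c ∈ C, ∀ μ : PMF X, failureProb A μ c α m ≤ ENNReal.ofReal β

/-- `(α, β, ε, δ, n, m)`-private semi-supervised learner for the concept class `C`. -/
def IsPSSL {X : Type*} [Fintype X] {n : ℕ} (α β ε δ : ℝ) (m : ℕ) (C : Set (X → Bool))
    (A : LearningAlgorithm X n) : Prop :=
  IsSSL α β m C A ∧ IsDifferentiallyPrivate ε δ A

/-- A learner is proper if, on every input, it only outputs hypotheses from `C`. -/
def IsProperLearner {X : Type*} {n : ℕ} (C : Set (X → Bool)) (A : LearningAlgorithm X n) : Prop :=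
  ∀ D : PartialDatabase X n, (A D).support ⊆ C

/-! The learner is a composition of two exponential mechanisms. The unlabeled examples select a
tuple `Z` of `k` points such that any two concepts of `C` agreeing on `Z` are close under `μ`. The
concepts are then represented, up to small error, by at most `2 ^ k` label patterns on `Z`, and the
labeled examples select one of these. Only the first selection ranges over a set whose size depends
on `d`, so `d` enters `n` but not `m`.

A good `Z` exists by an `ε`-net argument (`exists_net`), with `k` of order `VC(C) / α ^ 2`
(`exists_net_of_vcDim`).

Accuracy needs no uniform convergence. The probability of an outcome `ω` is at most `exp (s η - s
ω)` for any competitor `η` (`expMech_apply_le`). When `ω` is bad and `η` is good, the expectation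
over the sample decays like `exp (-(l * a * n / 4))` (`sum_prod_exp_boolCount_le`). A union bound
finishes, over `|X| ^ k * |C| ^ 2` terms in the first stage and `2 ^ k` in the second; `log |C|` is
at most `1 + d * VC(C)` by Sauer (`log_card_le`).

When `VC(C) = 0` or `d = 0`, the allowed sample size can be below 1, and a learner without data
takes over where needed. -/

/-! ### Counting traces by VC dimension. -/

/-- Sauer's lemma for the traces of a concept class on an indexed family of points. -/
theorem card_image_comp_le_sum_choose {X ι : Type*} [Fintype X] [DecidableEq X] [Fintype ι]
    [DecidableEq ι] (C : Finset (X → Bool)) (w : ι → X) :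
    (C.image fun c => c ∘ w).card
      ≤ ∑ j ∈ Finset.Iic (conceptVCDim (C : Set (X → Bool))), (Fintype.card ι).choose j := by
  classical
  set T : Finset (Finset ι) := (C.image fun c => c ∘ w).image
    (fun g => Finset.univ.filter fun i => g i = true) with hT
  have hcard : T.card = (C.image fun c => c ∘ w).card := by
    apply Finset.card_image_of_injective
    intro g g' h
    funext i
    have := congrArg (fun s => i ∈ s) h
    simp only [Finset.mem_filter, Finset.mem_univ, true_and, eq_iff_iff] at this
    exact Bool.eq_iff_iff.2 this
  have hvc : T.vcDim ≤ conceptVCDim (C : Set (X → Bool)) := by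
    refine Finset.sup_le fun S hS => ?_
    rw [Finset.mem_shatterer] at hS
    have key : ∀ t ⊆ S, ∃ c ∈ C, ∀ i ∈ S, c (w i) = true ↔ i ∈ t := by
      intro t ht
      obtain ⟨u, hu, hSu⟩ := hS ht
      simp only [hT, Finset.mem_image, exists_exists_and_eq_and] at hu
      obtain ⟨c, hc, rfl⟩ := hu
      refine ⟨c, hc, fun i hi => ?_⟩
      rw [← hSu]
      simp [hi]
    -- The family may repeat points, but a repeated point cannot be separated from itself, so a
    -- shattered index set has distinct points.
    have hinj : Set.InjOn w S := by
      intro i hi j hj hij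
      obtain ⟨c, -, h⟩ := key {i} (by simpa using hi)
      have h1 := (h i hi).2 (by simp)
      rw [hij, h j hj] at h1
      exact (Finset.mem_singleton.1 h1).symm
    rw [← Finset.card_image_of_injOn hinj]
    unfold conceptVCDim
    apply Finset.Shatters.card_le_vcDim
    intro t ht
    obtain ⟨c, hc, h⟩ := key (S.filter fun i => w i ∈ t) (Finset.filter_subset _ _)
    refine ⟨Finset.univ.filter fun x => c x = true, ?_, ?_⟩
    · simpa using hc
    · ext x
      simp only [Finset.mem_inter, Finset.mem_image, Finset.mem_filter, Finset.mem_univ, true_and]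
      constructor
      · rintro ⟨⟨i, hi, rfl⟩, hx⟩
        exact (Finset.mem_filter.1 ((h i hi).1 hx)).2
      · intro hx
        obtain ⟨i, hi, rfl⟩ := Finset.mem_image.1 (ht hx)
        exact ⟨⟨i, hi, rfl⟩, (h i hi).2 (Finset.mem_filter.2 ⟨hi, hx⟩)⟩
  rw [← hcard]
  refine (Finset.card_le_card_shatterer T).trans (Finset.card_shatterer_le_sum_vcDim.trans ?_)
  exact Finset.sum_le_sum_of_subset (Finset.Iic_subset_Iic.2 hvc)

/-- Since `x ^ V ≤ x ^ j` for `j ≤ V`, the binomial theorem applies. The parameter `x` stays free: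
it is `a / 32` for nets and `2 ^ (-d)` for the size of the class. -/
theorem sum_choose_le_one_add_pow_div (N V : ℕ) {x : ℝ} (hx : 0 < x) (hx1 : x ≤ 1) :
    ((∑ j ∈ Finset.Iic V, N.choose j : ℕ) : ℝ) ≤ (1 + x) ^ N / x ^ V := by
  rw [le_div_iff₀ (by positivity)]
  push_cast
  rw [Finset.sum_mul]
  calc ∑ j ∈ Finset.Iic V, (N.choose j : ℝ) * x ^ V
      ≤ ∑ j ∈ Finset.Iic V, (N.choose j : ℝ) * x ^ j := by
        refine Finset.sum_le_sum fun j hj => ?_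
        gcongr ?_ * ?_
        exact pow_le_pow_of_le_one hx.le hx1 (Finset.mem_Iic.1 hj)
    _ ≤ ∑ j ∈ Finset.range (V + N + 1), (N.choose j : ℝ) * x ^ j := by
        refine Finset.sum_le_sum_of_subset_of_nonneg ?_ fun _ _ _ => by positivity
        intro j hj
        simp only [Finset.mem_Iic, Finset.mem_range] at *
        omega
    _ = ∑ j ∈ Finset.range (N + 1), (N.choose j : ℝ) * x ^ j := by
        symm
        refine Finset.sum_subset ?_ fun j _ hj => ?_
        · exact Finset.range_subset_range.2 (by omega)
        · rw [Nat.choose_eq_zero_of_lt (by rw [Finset.mem_range] at hj; omega)]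
          simp
    _ = (1 + x) ^ N := by
        rw [add_comm 1 x, add_pow]
        exact Finset.sum_congr rfl fun j _ => by simp [mul_comm]

theorem card_image_comp_le {X ι : Type*} [Fintype X] [DecidableEq X] [Fintype ι]
    [DecidableEq ι] (C : Finset (X → Bool)) (w : ι → X) {x : ℝ} (hx : 0 < x) (hx1 : x ≤ 1) :
    ((C.image fun c => c ∘ w).card : ℝ)
      ≤ (1 + x) ^ Fintype.card ι / x ^ conceptVCDim (C : Set (X → Bool)) :=
  le_trans (by exact_mod_cast card_image_comp_le_sum_choose C w)
    (sum_choose_le_one_add_pow_div _ _ hx hx1)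

theorem card_le_sum_choose {X : Type*} [Fintype X] [DecidableEq X] (C : Finset (X → Bool)) :
    C.card ≤ ∑ j ∈ Finset.Iic (conceptVCDim (C : Set (X → Bool))), (Fintype.card X).choose j := by
  simpa using card_image_comp_le_sum_choose C (id : X → X)

/-! ### Existence of nets by double sampling. -/

/-- The weight that `p` gives to the set indicated by `f`. -/
def boolMass {X : Type*} [Fintype X] (p : X → ℝ) (f : X → Bool) : ℝ :=
  ∑ x, p x * if f x then 1 else 0

theorem sum_prod_eq_one {X : Type*} [Fintype X] {p : X → ℝ} (hp1 : ∑ x, p x = 1) (k : ℕ) :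
    ∑ z : Fin k → X, ∏ i, p (z i) = 1 := by
  rw [← Fintype.sum_pow, hp1, one_pow]

/-- The second half of the double sample is independent of the set determined by the first half, so
the expectation of the weight `2 ^ hits` factorizes. This weight replaces a tail bound on the number
of hits. -/
theorem one_add_pow_le_sum_of_boolMass {X : Type*} [Fintype X] {p : X → ℝ}
    (hp : ∀ x, 0 ≤ p x) (hp1 : ∑ x, p x = 1) {a : ℝ} (ha : 0 ≤ a) {k : ℕ}
    (F : (Fin k → X) → X → Bool) (hF : ∀ z, a ≤ boolMass p (F z)) :
    (1 + a) ^ k ≤ ∑ w : Fin k → Bool → X, (∏ i, ∏ b, p (w i b)) *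
      ∏ i, (1 + if F (fun i => w i false) (w i true) then (1 : ℝ) else 0) := by
  let e : (Fin k → Bool → X) ≃ (Fin k → X) × (Fin k → X) :=
    (Equiv.piComm _).trans (Equiv.boolArrowEquivProd _)
  have he : ∑ w : Fin k → Bool → X, (∏ i, ∏ b, p (w i b)) *
      ∏ i, (1 + if F (fun i => w i false) (w i true) then (1 : ℝ) else 0)
      = ∑ u : (Fin k → X) × (Fin k → X), (∏ i, p (u.1 i)) *
        ∏ i, (p (u.2 i) * (1 + if F u.1 (u.2 i) then (1 : ℝ) else 0)) := by
    refine Fintype.sum_equiv e _ _ fun w => ?_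
    have hew : e w = (fun i => w i false, fun i => w i true) := rfl
    simp only [hew, Fintype.prod_bool, Finset.prod_mul_distrib]
    ring
  rw [he, Fintype.sum_prod_type]
  calc (1 + a) ^ k = ∑ z : Fin k → X, (∏ i, p (z i)) * (1 + a) ^ k := by
        rw [← Finset.sum_mul, sum_prod_eq_one hp1, one_mul]
    _ ≤ _ := by
        refine Finset.sum_le_sum fun z _ => ?_
        dsimp only
        rw [← Finset.mul_sum, ← Fintype.sum_pow
          (fun x => p x * (1 + if F z x then (1 : ℝ) else 0))]
        have := Finset.prod_nonneg fun i (_ : i ∈ Finset.univ) => hp (z i)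
        gcongr
        simp only [mul_add, Finset.sum_add_distrib, mul_one, hp1]
        gcongr
        exact hF z

/-- The sum over swaps factorizes over the pairs. A pair contributes `1 + 1` if `g` hits neither
point, `0 + 2` if it hits one, and `0` if it hits both. -/
theorem sum_prod_swap_le {k : ℕ} (g : Fin k → Bool → Bool) :
    ∑ s : Fin k → Bool, ∏ i, (if g i (s i) then (0 : ℝ) else if g i (!s i) then 2 else 1)
      ≤ 2 ^ k := by
  rw [← Fintype.prod_sum (fun i b => if g i b then (0 : ℝ) else if g i (!b) then 2 else 1)]
  calc _ ≤ ∏ _i : Fin k, (2 : ℝ) := by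
        refine Finset.prod_le_prod (fun i _ => Finset.sum_nonneg fun b _ => ?_) fun i _ => ?_
        · split_ifs <;> norm_num
        · rw [Fintype.sum_bool, Bool.not_true, Bool.not_false]
          cases g i true <;> cases g i false <;> norm_num
    _ = 2 ^ k := by simp

/-- The involution of `Bool`-indexed pairs that swaps the pairs selected by `s`. -/
def swapEquiv {X : Type*} {k : ℕ} (s : Fin k → Bool) : (Fin k → Bool → X) ≃ (Fin k → Bool → X) :=
  Function.Involutive.toPerm (fun w i b => w i (b ^^ s i)) fun w => by
    funext i b
    simp

@[simp]
theorem swapEquiv_apply {X : Type*} {k : ℕ} (s : Fin k → Bool) (w : Fin k → Bool → X) (i : Fin k)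
    (b : Bool) : swapEquiv s w i b = w i (b ^^ s i) := rfl

theorem prod_swapEquiv {X : Type*} {p : X → ℝ} {k : ℕ} (s : Fin k → Bool)
    (w : Fin k → Bool → X) :
    ∏ i, ∏ b, p (swapEquiv s w i b) = ∏ i, ∏ b, p (w i b) := by
  refine Finset.prod_congr rfl fun i _ => ?_
  simp only [swapEquiv_apply, Fintype.prod_bool]
  cases s i <;> simp [mul_comm]

/-- The `ε`-net theorem for the symmetric differences of a class, by random swaps. -/
theorem exists_net {X : Type*} [Fintype X] [DecidableEq X] (C : Finset (X → Bool)) {p : X → ℝ}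
    (hp : ∀ x, 0 ≤ p x) (hp1 : ∑ x, p x = 1) {a : ℝ} (ha : 0 ≤ a) {k : ℕ} {P : ℝ}
    (hP : ∀ w : Fin k × Bool → X, ((C.image fun c => c ∘ w).card : ℝ) ≤ P)
    (hk : P ^ 2 < (1 + a) ^ k) :
    ∃ Z : Fin k → X, ∀ c ∈ C, ∀ c' ∈ C, (∀ i, c (Z i) = c' (Z i)) →
      boolMass p (fun x => c x ^^ c' x) ≤ a := by
  classical
  by_contra! hcon
  choose c hc c' hc' heq hlt using hcon
  set F : (Fin k → X) → X → Bool := fun z x => c z x ^^ c' z x with hF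
  have hFz : ∀ z i, F z (z i) = false := fun z i => by simp [hF, heq z i]
  set Φ : (Fin k → Bool → X) → ℝ := fun w =>
    ∏ i, (1 + if F (fun i => w i false) (w i true) then (1 : ℝ) else 0) with hΦ
  have hlow : ∀ s : Fin k → Bool, (1 + a) ^ k ≤
      ∑ w : Fin k → Bool → X, (∏ i, ∏ b, p (w i b)) * Φ (swapEquiv s w) := by
    intro s
    refine (one_add_pow_le_sum_of_boolMass hp hp1 ha F fun z => (hlt z).le).trans_eq ?_
    rw [← Equiv.sum_comp (swapEquiv s)]
    simp only [prod_swapEquiv, hΦ]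
  have hup : ∀ w : Fin k → Bool → X, ∑ s, Φ (swapEquiv s w) ≤ P ^ 2 * 2 ^ k := by
    intro w
    set I := C.image fun c => c ∘ fun q : Fin k × Bool => w q.1 q.2 with hI
    set R : Finset (Fin k → Bool → Bool) :=
      (I ×ˢ I).image fun u i b => u.1 (i, b) ^^ u.2 (i, b) with hR
    have hRc : (R.card : ℝ) ≤ P ^ 2 := by
      calc (R.card : ℝ) ≤ ((I ×ˢ I).card : ℝ) := by exact_mod_cast Finset.card_image_le
        _ = (I.card : ℝ) ^ 2 := by rw [Finset.card_product]; push_cast; ring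
        _ ≤ P ^ 2 := by gcongr; exact hP _
    calc ∑ s, Φ (swapEquiv s w)
        ≤ ∑ s : Fin k → Bool, ∑ g ∈ R,
          ∏ i, (if g i (s i) then (0 : ℝ) else if g i (!s i) then 2 else 1) := by
          refine Finset.sum_le_sum fun s _ => ?_
          set z : Fin k → X := fun i => w i (s i) with hz
          have hmem : (fun i b => F z (w i b)) ∈ R := by
            refine Finset.mem_image.2 ⟨(fun q => c z (w q.1 q.2), fun q => c' z (w q.1 q.2)), ?_,
              rfl⟩
            exact Finset.mk_mem_product (Finset.mem_image.2 ⟨_, hc z, rfl⟩)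
              (Finset.mem_image.2 ⟨_, hc' z, rfl⟩)
          refine le_trans (le_of_eq ?_) (Finset.single_le_sum (f := fun g : Fin k → Bool → Bool =>
            ∏ i, (if g i (s i) then (0 : ℝ) else if g i (!s i) then 2 else 1))
            (fun g _ => Finset.prod_nonneg fun i _ => ?_) hmem)
          · refine Finset.prod_congr rfl fun i _ => ?_
            have h1 : F z (w i (s i)) = false := hFz z i
            have h2 : (fun i => swapEquiv s w i false) = z := by
              funext i
              simp [hz]
            have h3 : swapEquiv s w i true = w i (!s i) := by
              simp
            rw [h2, h3, h1]
            cases F z (w i !s i) <;> norm_num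
          · split_ifs <;> norm_num
      _ = ∑ g ∈ R, ∑ s : Fin k → Bool,
          ∏ i, (if g i (s i) then (0 : ℝ) else if g i (!s i) then 2 else 1) := Finset.sum_comm
      _ ≤ ∑ _g ∈ R, (2 : ℝ) ^ k := Finset.sum_le_sum fun g _ => sum_prod_swap_le g
      _ = R.card * 2 ^ k := by simp
      _ ≤ P ^ 2 * 2 ^ k := by gcongr
  have htot : ∑ w : Fin k → Bool → X, ∏ i, ∏ b, p (w i b) = 1 := by
    have := Fintype.sum_pow (fun v : Bool → X => ∏ b, p (v b)) k
    rw [← this, ← Fintype.prod_sum (fun (_ : Bool) x => p x)]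
    simp [hp1]
  have : 2 ^ k * (1 + a) ^ k ≤ P ^ 2 * 2 ^ k := by
    calc (2 : ℝ) ^ k * (1 + a) ^ k = ∑ _s : Fin k → Bool, (1 + a) ^ k := by simp
      _ ≤ ∑ s : Fin k → Bool,
          ∑ w : Fin k → Bool → X, (∏ i, ∏ b, p (w i b)) * Φ (swapEquiv s w) :=
        Finset.sum_le_sum fun s _ => hlow s
      _ = ∑ w : Fin k → Bool → X, (∏ i, ∏ b, p (w i b)) * ∑ s, Φ (swapEquiv s w) := by
        rw [Finset.sum_comm]
        simp only [Finset.mul_sum]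
      _ ≤ ∑ w : Fin k → Bool → X, (∏ i, ∏ b, p (w i b)) * (P ^ 2 * 2 ^ k) := by
        refine Finset.sum_le_sum fun w _ => mul_le_mul_of_nonneg_left (hup w) ?_
        exact Finset.prod_nonneg fun i _ => Finset.prod_nonneg fun b _ => hp _
      _ = P ^ 2 * 2 ^ k := by rw [← Finset.sum_mul, htot, one_mul]
  have h2 : (0 : ℝ) < 2 ^ k := by positivity
  nlinarith

/-! ### The exponential mechanism and pure privacy. -/

/-- The exponential mechanism with score `s`: outputs `ω` with probability proportional to
`exp (-s ω)`. -/
noncomputable def expMech {Ω : Type*} [Fintype Ω] [Nonempty Ω] (s : Ω → ℝ) : PMF Ω :=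
  PMF.ofFintype (fun ω => ENNReal.ofReal (Real.exp (-s ω) / ∑ η, Real.exp (-s η))) <| by
    rw [← ENNReal.ofReal_sum_of_nonneg fun ω _ => by positivity, ← Finset.sum_div, div_self,
      ENNReal.ofReal_one]
    exact (Finset.sum_pos (fun η _ => Real.exp_pos _) Finset.univ_nonempty).ne'

section ExpMech

variable {Ω : Type*} [Fintype Ω] [Nonempty Ω]

theorem expMech_apply (s : Ω → ℝ) (ω : Ω) :
    expMech s ω = ENNReal.ofReal (Real.exp (-s ω) / ∑ η, Real.exp (-s η)) := rfl

/-- The normalizing sum is at least its single term at `η`. -/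
theorem expMech_apply_le (s : Ω → ℝ) (ω η : Ω) :
    expMech s ω ≤ ENNReal.ofReal (Real.exp (s η - s ω)) := by
  rw [expMech_apply]
  apply ENNReal.ofReal_le_ofReal
  rw [sub_eq_neg_add, Real.exp_add, ← neg_neg (s η), Real.exp_neg (-s η), ← div_eq_mul_inv]
  gcongr
  exact Finset.single_le_sum (f := fun η => Real.exp (-s η)) (fun _ _ => (Real.exp_pos _).le)
    (Finset.mem_univ η)

/-- One factor `exp l` comes from the weight of `ω`, the other from the normalizing sum. -/
theorem expMech_apply_le_mul {s s' : Ω → ℝ} {l : ℝ} (h : ∀ ω, s ω ≤ s' ω + l)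
    (h' : ∀ ω, s' ω ≤ s ω + l) (ω : Ω) :
    expMech s ω ≤ ENNReal.ofReal (Real.exp (2 * l)) * expMech s' ω := by
  rw [expMech_apply, expMech_apply, ← ENNReal.ofReal_mul (Real.exp_pos _).le]
  apply ENNReal.ofReal_le_ofReal
  have hpos : ∀ t : Ω → ℝ, 0 < ∑ η, Real.exp (-t η) := fun t =>
    Finset.sum_pos (fun η _ => Real.exp_pos _) Finset.univ_nonempty
  have h1 : Real.exp (-s ω) ≤ Real.exp l * Real.exp (-s' ω) := by
    rw [← Real.exp_add]
    exact Real.exp_le_exp.2 (by linarith [h' ω])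
  have h2 : ∑ η, Real.exp (-s' η) ≤ Real.exp l * ∑ η, Real.exp (-s η) := by
    rw [Finset.mul_sum]
    refine Finset.sum_le_sum fun η _ => ?_
    rw [← Real.exp_add]
    exact Real.exp_le_exp.2 (by linarith [h η])
  rw [← mul_div_assoc, div_le_div_iff₀ (hpos s) (hpos s'), two_mul, Real.exp_add]
  calc Real.exp (-s ω) * ∑ η, Real.exp (-s' η)
      ≤ (Real.exp l * Real.exp (-s' ω)) * (Real.exp l * ∑ η, Real.exp (-s η)) := by
        gcongr
    _ = _ := by ring

end ExpMech

theorem PMF.bind_apply_le_mul {Ω O : Type*} {P Q : PMF Ω} {f g : Ω → PMF O} {a b : ℝ≥0∞}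
    (h : ∀ ω, P ω ≤ a * Q ω) (h' : ∀ ω o, f ω o ≤ b * g ω o) (o : O) :
    P.bind f o ≤ a * b * Q.bind g o := by
  rw [PMF.bind_apply, PMF.bind_apply, ← ENNReal.tsum_mul_left]
  refine ENNReal.tsum_le_tsum fun ω => ?_
  calc P ω * f ω o ≤ (a * Q ω) * (b * g ω o) := mul_le_mul' (h ω) (h' ω o)
    _ = _ := by ring

theorem PMF.toOuterMeasure_le_mul {O : Type*} {P Q : PMF O} {a : ℝ≥0∞} (h : ∀ o, P o ≤ a * Q o)
    (F : Set O) : P.toOuterMeasure F ≤ a * Q.toOuterMeasure F := by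
  rw [PMF.toOuterMeasure_apply, PMF.toOuterMeasure_apply, ← ENNReal.tsum_mul_left]
  refine ENNReal.tsum_le_tsum fun o => ?_
  by_cases ho : o ∈ F <;> simp [ho, h o]

theorem PMF.map_apply_le_mul {Ω O : Type*} {P Q : PMF Ω} {a : ℝ≥0∞} (h : ∀ ω, P ω ≤ a * Q ω)
    (f : Ω → O) (o : O) : P.map f o ≤ a * Q.map f o := by
  classical
  rw [PMF.map_apply, PMF.map_apply, ← ENNReal.tsum_mul_left]
  refine ENNReal.tsum_le_tsum fun ω => ?_
  by_cases ho : o = f ω <;> simp [ho, h ω]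

theorem PMF.toOuterMeasure_le_one {O : Type*} (P : PMF O) (F : Set O) :
    P.toOuterMeasure F ≤ 1 := by
  rw [PMF.toOuterMeasure_apply, ← P.tsum_coe]
  exact ENNReal.tsum_le_tsum fun o => Set.indicator_le_self _ _ _

theorem card_filter_le_of_neighboring {E : Type*} {n m : ℕ} {D D' : Fin n → E}
    (h : Neighboring D D') {e : Fin m → Fin n} (he : Function.Injective e) (P : E → Prop)
    [DecidablePred P] :
    (Finset.univ.filter fun i => P (D (e i))).card
      ≤ (Finset.univ.filter fun i => P (D' (e i))).card + 1 := by
  obtain ⟨i₀, -, h₀⟩ := h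
  have h1 : (Finset.univ.filter fun i => e i = i₀).card ≤ 1 :=
    Finset.card_le_one.2 fun a ha b hb => he (by simp_all)
  refine le_trans (Finset.card_le_card ?_) ((Finset.card_union_le _ _).trans
    (Nat.add_le_add_left h1 _))
  intro i hi
  simp only [Finset.mem_union, Finset.mem_filter, Finset.mem_univ, true_and] at hi ⊢
  by_cases hii : e i = i₀
  · exact Or.inr hii
  · have : D (e i) = D' (e i) := by
      by_contra hne
      exact hii (h₀ _ hne)
    exact Or.inl (this ▸ hi)

theorem Neighboring.symm {E : Type*} {n : ℕ} {D D' : Fin n → E} (h : Neighboring D D') :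
    Neighboring D' D := by
  simpa only [Neighboring, ne_comm] using h

/-! ### Exponential moments of count differences. -/

/-- The number of entries of `y` in the set indicated by `f`. -/
def boolCount {X : Type*} {n : ℕ} (f : X → Bool) (y : Fin n → X) : ℕ :=
  (Finset.univ.filter fun i => f (y i) = true).card

/-- The expectation is the `n`-th power of a one-example expectation. By `exp l ≤ 1 + 2 * l` and
`exp (-l) ≤ 1 - l / 2` the latter is at most `1 + 2 * l * (a / 8) - l / 2 * a = 1 - l * a / 4`,
which explains the gap factor 8. -/
theorem sum_prod_exp_boolCount_le {X : Type*} [Fintype X] {p : X → ℝ} (hp : ∀ x, 0 ≤ p x)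
    (hp1 : ∑ x, p x = 1) {l a : ℝ} (hl : 0 ≤ l) (hl1 : l ≤ 1) {f g : X → Bool}
    (hg : boolMass p g ≤ a / 8) (hf : a ≤ boolMass p f) (n : ℕ) :
    ∑ y : Fin n → X, (∏ i, p (y i)) *
        Real.exp (l * boolCount g y - l * boolCount f y) ≤ Real.exp (-(l * a * n / 4)) := by
  have hprod : ∀ y : Fin n → X, (∏ i, p (y i)) *
      Real.exp (l * boolCount g y - l * boolCount f y) = ∏ i, (p (y i) *
        Real.exp (l * (if g (y i) then 1 else 0) - l * (if f (y i) then 1 else 0))) := by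
    intro y
    rw [Finset.prod_mul_distrib, ← Real.exp_sum, Finset.sum_sub_distrib, ← Finset.mul_sum,
      ← Finset.mul_sum, boolCount, boolCount, Finset.natCast_card_filter,
      Finset.natCast_card_filter]
  simp_rw [hprod]
  rw [← Fintype.sum_pow (fun x => p x *
    Real.exp (l * (if g x then 1 else 0) - l * (if f x then 1 else 0)))]
  have e1 : Real.exp l ≤ 1 + 2 * l := by
    have := Real.abs_exp_sub_one_sub_id_le (x := l) (by rw [abs_of_nonneg hl]; exact hl1)
    have := (abs_le.1 this).2
    nlinarith
  have e2 : Real.exp (-l) ≤ 1 - l / 2 := by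
    have h1 : Real.exp (-l) * Real.exp l = 1 := by rw [← Real.exp_add]; simp
    have h2 := Real.add_one_le_exp l
    have h3 := Real.exp_pos (-l)
    nlinarith
  have hpt : ∀ x, p x * Real.exp (l * (if g x then 1 else 0) - l * (if f x then 1 else 0))
      ≤ p x + 2 * l * (p x * if g x then 1 else 0) - l / 2 * (p x * if f x then 1 else 0) := by
    intro x
    have hx := hp x
    cases g x <;> cases f x <;> simp <;> nlinarith
  have hsum : ∑ x, p x * Real.exp (l * (if g x then 1 else 0) - l * (if f x then 1 else 0))
      ≤ Real.exp (-(l * a / 4)) := by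
    refine (Finset.sum_le_sum fun x _ => hpt x).trans ?_
    rw [Finset.sum_sub_distrib, Finset.sum_add_distrib, ← Finset.mul_sum, ← Finset.mul_sum, hp1]
    change 1 + 2 * l * boolMass p g - l / 2 * boolMass p f ≤ _
    have := Real.add_one_le_exp (-(l * a / 4))
    nlinarith [mul_le_mul_of_nonneg_left hg hl, mul_le_mul_of_nonneg_left hf hl]
  calc _ ≤ Real.exp (-(l * a / 4)) ^ n := by
        refine pow_le_pow_left₀ (Finset.sum_nonneg fun x _ => ?_) hsum n
        have := hp x
        positivity
    _ = _ := by
        rw [← Real.exp_nat_mul]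
        ring_nf

theorem PMF.sum_toReal {X : Type*} [Fintype X] (μ : PMF X) : ∑ x, (μ x).toReal = 1 := by
  rw [← ENNReal.toReal_sum fun x _ => μ.apply_ne_top x, ← tsum_fintype (L := .unconditional X),
    μ.tsum_coe, ENNReal.toReal_one]

theorem PMF.sum_prod_exp_boolCount_le {X : Type*} [Fintype X] (μ : PMF X)
    {l a : ℝ} (hl : 0 ≤ l) (hl1 : l ≤ 1) {f g : X → Bool}
    (hg : boolMass (fun x => (μ x).toReal) g ≤ a / 8)
    (hf : a ≤ boolMass (fun x => (μ x).toReal) f) (n : ℕ) :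
    ∑ y : Fin n → X, (∏ i, μ (y i)) *
        ENNReal.ofReal (Real.exp (l * boolCount g y - l * boolCount f y))
      ≤ ENNReal.ofReal (Real.exp (-(l * a * n / 4))) := by
  refine le_trans (le_of_eq ?_) (ENNReal.ofReal_le_ofReal
    (_root_.sum_prod_exp_boolCount_le (fun x => ENNReal.toReal_nonneg) μ.sum_toReal hl hl1 hg hf n))
  have hprod : ∀ y : Fin n → X, 0 ≤ ∏ i, (μ (y i)).toReal := fun y =>
    Finset.prod_nonneg fun i _ => ENNReal.toReal_nonneg
  rw [ENNReal.ofReal_sum_of_nonneg fun y _ => mul_nonneg (hprod y) (Real.exp_pos _).le]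
  refine Finset.sum_congr rfl fun y _ => ?_
  rw [ENNReal.ofReal_mul (hprod y),
    ENNReal.ofReal_prod_of_nonneg fun i _ => ENNReal.toReal_nonneg]
  congr 1
  exact Finset.prod_congr rfl fun i _ => (ENNReal.ofReal_toReal (μ.apply_ne_top _)).symm

theorem genError_eq_boolMass {X : Type*} [Fintype X] (μ : PMF X) (c h : X → Bool) :
    genError μ c h = boolMass (fun x => (μ x).toReal) fun x => h x ^^ c x := by
  rw [genError, PMF.toOuterMeasure_apply_fintype, ENNReal.toReal_sum, boolMass]
  · refine Finset.sum_congr rfl fun x _ => ?_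
    by_cases hx : h x = c x <;> simp [hx, Set.indicator]
  · intro x _
    by_cases hx : h x = c x <;> simp [hx, Set.indicator, μ.apply_ne_top]

theorem PMF.sum_prod_apply {X : Type*} [Fintype X] (μ : PMF X) (n : ℕ) :
    ∑ y : Fin n → X, ∏ i, μ (y i) = 1 := by
  rw [← Fintype.sum_pow, ← tsum_fintype (L := .unconditional X), μ.tsum_coe, one_pow]

/-! ### The learner, its properness and its privacy. -/

section Learner

variable {X : Type*} {k m n : ℕ}

/-- The pairs of concepts of `C` that agree on the points `Z`. -/
def agreePairs (C : Finset (X → Bool)) (Z : Fin k → X) : Finset ((X → Bool) × (X → Bool)) :=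
  (C ×ˢ C).filter fun u => ∀ i, u.1 (Z i) = u.2 (Z i)

/-- The largest number of examples in `y` on which two concepts that agree on `Z` differ. -/
def netScore (C : Finset (X → Bool)) (y : Fin n → X) (Z : Fin k → X) : ℕ :=
  (agreePairs C Z).sup fun u => boolCount (fun x => u.1 x ^^ u.2 x) y

/-- The number of labeled examples that `h` misclassifies. -/
def labelErrors (h : X → Bool) (D : PartialDatabase X m) : ℕ :=
  (Finset.univ.filter fun i => (D i).2 = some (!h (D i).1)).card

open Classical in
/-- A concept of `C` with the values `v` at the points `Z`, if there is one, and `c₀` otherwise. -/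
noncomputable def concept (C : Finset (X → Bool)) (c₀ : X → Bool) (Z : Fin k → X)
    (v : Fin k → Bool) : X → Bool :=
  if h : ∃ c ∈ C, ∀ i, c (Z i) = v i then h.choose else c₀

theorem concept_mem {C : Finset (X → Bool)} {c₀ : X → Bool} (h₀ : c₀ ∈ C) (Z : Fin k → X)
    (v : Fin k → Bool) : concept C c₀ Z v ∈ C := by
  unfold concept
  split_ifs with h
  · exact h.choose_spec.1
  · exact h₀

theorem concept_apply {C : Finset (X → Bool)} (c₀ : X → Bool) (Z : Fin k → X) {c : X → Bool}
    (hc : c ∈ C) (i : Fin k) : concept C c₀ Z (fun i => c (Z i)) (Z i) = c (Z i) := by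
  have h : ∃ c' ∈ C, ∀ i, c' (Z i) = (fun i => c (Z i)) i := ⟨c, hc, fun _ => rfl⟩
  unfold concept
  rw [dif_pos h]
  exact h.choose_spec.2 i

theorem labelErrors_eq_boolCount (h c : X → Bool) (y : Fin m → X) :
    labelErrors h (fun i => (y i, some (c (y i)))) = boolCount (fun x => h x ^^ c x) y := by
  unfold labelErrors boolCount
  congr 1
  ext i
  simp only [Finset.mem_filter, Finset.mem_univ, true_and]
  cases h (y i) <;> cases c (y i) <;> simp

/-- The learner that privately selects a net of `k` points with the last `n` examples, and then
privately selects one of the concepts that represent the traces on the net, with the first `m`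
examples. -/
noncomputable def netLearner [Fintype X] [Nonempty X] (C : Finset (X → Bool)) (c₀ : X → Bool) (k m n : ℕ)
    (l : ℝ) : LearningAlgorithm X (m + n) := fun D =>
  (expMech fun Z : Fin k → X => l * netScore C (fun j => (D (Fin.natAdd m j)).1) Z).bind fun Z =>
    (expMech fun v : Fin k → Bool =>
      l * labelErrors (concept C c₀ Z v) fun i => D (Fin.castAdd n i)).map (concept C c₀ Z)

theorem netLearner_isProperLearner [Fintype X] [Nonempty X] {C : Finset (X → Bool)} {c₀ : X → Bool}
    (h₀ : c₀ ∈ C) (l : ℝ) :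
    IsProperLearner (C : Set (X → Bool)) (netLearner C c₀ k m n l) := by
  intro D h hh
  rw [netLearner, PMF.mem_support_bind_iff] at hh
  obtain ⟨Z, -, hZ⟩ := hh
  obtain ⟨v, -, rfl⟩ := (PMF.mem_support_map_iff _ _ _).1 hZ
  exact concept_mem h₀ Z v

theorem netScore_le_of_neighboring {D D' : PartialDatabase X (m + n)} (h : Neighboring D D')
    (C : Finset (X → Bool)) (Z : Fin k → X) :
    netScore C (fun j => (D (Fin.natAdd m j)).1) Z
      ≤ netScore C (fun j => (D' (Fin.natAdd m j)).1) Z + 1 := by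
  refine Finset.sup_le fun u hu => ?_
  refine (card_filter_le_of_neighboring h (Fin.natAdd_injective n m)
    (fun q => (u.1 q.1 ^^ u.2 q.1) = true)).trans (Nat.add_le_add_right ?_ 1)
  exact Finset.le_sup (f := fun u : (X → Bool) × (X → Bool) =>
    boolCount (fun x => u.1 x ^^ u.2 x) fun j => (D' (Fin.natAdd m j)).1) hu

theorem netLearner_isDifferentiallyPrivate [Fintype X] [Nonempty X] (C : Finset (X → Bool)) (c₀ : X → Bool)
    {l ε : ℝ} (hl : 0 ≤ l) (hlε : 4 * l ≤ ε) :
    IsDifferentiallyPrivate ε 0 (netLearner C c₀ k m n l) := by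
  intro D D' hD F
  rw [ENNReal.ofReal_zero, add_zero]
  refine PMF.toOuterMeasure_le_mul (fun o => ?_) F
  have key : ∀ a b : ℕ, a ≤ b + 1 → l * a ≤ l * b + l := fun a b hab => by
    have : (a : ℝ) ≤ b + 1 := by exact_mod_cast hab
    nlinarith
  -- The changed entry lies in only one of the two blocks, but both stages are charged `exp (2 *
  -- l)`; this avoids a case split and costs a constant.
  have h : netLearner C c₀ k m n l D o ≤ ENNReal.ofReal (Real.exp (2 * l)) *
      ENNReal.ofReal (Real.exp (2 * l)) * netLearner C c₀ k m n l D' o := by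
    refine PMF.bind_apply_le_mul (expMech_apply_le_mul
      (fun Z => key _ _ (netScore_le_of_neighboring hD C Z))
      fun Z => key _ _ (netScore_le_of_neighboring hD.symm C Z)) (fun Z o => ?_) o
    refine PMF.map_apply_le_mul (expMech_apply_le_mul (fun v => key _ _ ?_)
      fun v => key _ _ ?_) _ o
    · exact card_filter_le_of_neighboring hD (Fin.castAdd_injective m n)
        (fun q => q.2 = some (!concept C c₀ Z v q.1))
    · exact card_filter_le_of_neighboring hD.symm (Fin.castAdd_injective m n)
        (fun q => q.2 = some (!concept C c₀ Z v q.1))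
  refine h.trans ?_
  rw [← ENNReal.ofReal_mul (Real.exp_pos _).le, ← Real.exp_add]
  gcongr
  linarith

end Learner

/-! ### Accuracy of the learner. -/

/-- A two-stage experiment with independent data for the stages fails with probability at most the
sum of the failure probabilities of the stages. -/
theorem sum_sum_two_stage_le {Y W Ω : Type*} [Fintype Y] [Fintype W] [Fintype Ω]
    {u : Y → ℝ≥0∞} {v : W → ℝ≥0∞} (hu : ∑ y, u y = 1) (hv : ∑ z, v z = 1)
    {P : W → Ω → ℝ≥0∞} {Q : Y → Ω → ℝ≥0∞} (hP : ∀ z, ∑ ω, P z ω = 1) (hQ : ∀ y ω, Q y ω ≤ 1)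
    (G : Ω → Prop) [DecidablePred G] {a b : ℝ≥0∞}
    (ha : ∑ z, v z * ∑ ω with ¬ G ω, P z ω ≤ a)
    (hb : ∀ ω, G ω → ∑ y, u y * Q y ω ≤ b) :
    ∑ y, ∑ z, u y * v z * ∑ ω, P z ω * Q y ω ≤ a + b := by
  have h1 : ∀ y z, ∑ ω, P z ω * Q y ω
      ≤ ∑ ω with ¬ G ω, P z ω + ∑ ω with G ω, P z ω * Q y ω := by
    intro y z
    rw [← Finset.sum_filter_add_sum_filter_not Finset.univ G, add_comm]
    gcongr with ω
    exact mul_le_of_le_one_right' (hQ y ω)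
  calc ∑ y, ∑ z, u y * v z * ∑ ω, P z ω * Q y ω
      ≤ ∑ y, ∑ z, u y * v z * (∑ ω with ¬ G ω, P z ω + ∑ ω with G ω, P z ω * Q y ω) := by
        gcongr
        exact h1 _ _
    _ = (∑ y, u y) * (∑ z, v z * ∑ ω with ¬ G ω, P z ω)
        + ∑ z, v z * ∑ ω with G ω, P z ω * ∑ y, u y * Q y ω := by
        simp only [mul_add, Finset.sum_add_distrib]
        congr 1
        · rw [Finset.sum_mul_sum]
          simp only [mul_assoc]
        · simp only [Finset.mul_sum]
          rw [Finset.sum_comm]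
          refine Finset.sum_congr rfl fun z _ => ?_
          rw [Finset.sum_comm]
          refine Finset.sum_congr rfl fun ω _ => Finset.sum_congr rfl fun y _ => by ring
    _ ≤ 1 * a + ∑ z, v z * ∑ ω with G ω, P z ω * b := by
        rw [hu]
        gcongr with z _ ω hω
        exact hb ω (Finset.mem_filter.1 hω).2
    _ ≤ 1 * a + ∑ z, v z * (1 * b) := by
        gcongr with z
        rw [← Finset.sum_mul, ← hP z]
        gcongr
        exact Finset.filter_subset _ _
    _ = a + b := by rw [← Finset.sum_mul, hv, one_mul, one_mul, one_mul]

section Accuracy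

variable {X : Type*} [Fintype X] {k m n : ℕ}

/-- The pair attaining the score of `Z'` depends on the sample `y`. Summing over all agreeing pairs
removes this dependence before the expectation is taken. -/
theorem expMech_netScore_apply_le [Nonempty X] {C : Finset (X → Bool)} (hC : C.Nonempty) {l : ℝ} (hl : 0 ≤ l)
    (y : Fin n → X) (Z Z' : Fin k → X) {u : (X → Bool) × (X → Bool)} (hu : u ∈ agreePairs C Z) :
    expMech (fun Z => l * netScore C y Z) Z ≤ ∑ u' ∈ agreePairs C Z', ENNReal.ofReal (Real.exp
      (l * boolCount (fun x => u'.1 x ^^ u'.2 x) y - l * boolCount (fun x => u.1 x ^^ u.2 x) y)) := by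
  obtain ⟨c, hc⟩ := hC
  have hne : (agreePairs C Z').Nonempty := ⟨(c, c), by simp [agreePairs, hc]⟩
  obtain ⟨u', hu', he⟩ := Finset.exists_mem_eq_sup _ hne
    (fun u : (X → Bool) × (X → Bool) => boolCount (fun x => u.1 x ^^ u.2 x) y)
  refine (expMech_apply_le _ Z Z').trans (le_trans ?_ (Finset.single_le_sum
    (f := fun u' : (X → Bool) × (X → Bool) => ENNReal.ofReal (Real.exp
      (l * boolCount (fun x => u'.1 x ^^ u'.2 x) y - l * boolCount (fun x => u.1 x ^^ u.2 x) y)))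
    (fun _ _ => zero_le) hu'))
  have h1 : boolCount (fun x => u.1 x ^^ u.2 x) y ≤ netScore C y Z :=
    Finset.le_sup (f := fun u : (X → Bool) × (X → Bool) =>
      boolCount (fun x => u.1 x ^^ u.2 x) y) hu
  have h2 : netScore C y Z' = boolCount (fun x => u'.1 x ^^ u'.2 x) y := he
  rw [h2]
  gcongr

theorem sum_prod_mul_expMech_netScore_le [Nonempty X] {C : Finset (X → Bool)} (hC : C.Nonempty) (μ : PMF X)
    {l a : ℝ} (hl : 0 ≤ l) (hl1 : l ≤ 1) {Z₀ : Fin k → X}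
    (hZ₀ : ∀ u ∈ agreePairs C Z₀, boolMass (fun x => (μ x).toReal) (fun x => u.1 x ^^ u.2 x) ≤ a / 8)
    (G : (Fin k → X) → Prop) [DecidablePred G]
    (hG : ∀ Z, ¬ G Z → ∃ u ∈ agreePairs C Z,
      a ≤ boolMass (fun x => (μ x).toReal) (fun x => u.1 x ^^ u.2 x)) :
    ∑ y : Fin n → X, (∏ i, μ (y i)) *
        ∑ Z with ¬ G Z, expMech (fun Z : Fin k → X => l * netScore C y Z) Z
      ≤ ENNReal.ofReal ((Fintype.card X : ℝ) ^ k * (C.card : ℝ) ^ 2 *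
        Real.exp (-(l * a * n / 4))) := by
  simp only [Finset.mul_sum]
  rw [Finset.sum_comm]
  have hZ : ∀ Z : Fin k → X, ¬ G Z → ∑ y : Fin n → X, (∏ i, μ (y i)) *
      expMech (fun Z : Fin k → X => l * netScore C y Z) Z
      ≤ ENNReal.ofReal ((C.card : ℝ) ^ 2 * Real.exp (-(l * a * n / 4))) := by
    intro Z hZ
    obtain ⟨u, hu, hau⟩ := hG Z hZ
    calc _ ≤ ∑ y : Fin n → X, (∏ i, μ (y i)) * ∑ u' ∈ agreePairs C Z₀, ENNReal.ofReal (Real.exp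
          (l * boolCount (fun x => u'.1 x ^^ u'.2 x) y
            - l * boolCount (fun x => u.1 x ^^ u.2 x) y)) := by
          gcongr with y
          exact expMech_netScore_apply_le hC hl y Z Z₀ hu
      _ = ∑ u' ∈ agreePairs C Z₀, ∑ y : Fin n → X, (∏ i, μ (y i)) * ENNReal.ofReal (Real.exp
          (l * boolCount (fun x => u'.1 x ^^ u'.2 x) y
            - l * boolCount (fun x => u.1 x ^^ u.2 x) y)) := by
          simp only [Finset.mul_sum]
          exact Finset.sum_comm
      _ ≤ ∑ _u' ∈ agreePairs C Z₀, ENNReal.ofReal (Real.exp (-(l * a * n / 4))) := by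
          gcongr with u' hu'
          exact μ.sum_prod_exp_boolCount_le hl hl1 (hZ₀ u' hu') hau n
      _ = ENNReal.ofReal ((agreePairs C Z₀).card * Real.exp (-(l * a * n / 4))) := by
          rw [Finset.sum_const, ENNReal.ofReal_mul (by positivity), ENNReal.ofReal_natCast,
            nsmul_eq_mul]
      _ ≤ _ := by
          gcongr
          have : (agreePairs C Z₀).card ≤ C.card ^ 2 := by
            refine (Finset.card_filter_le _ _).trans ?_
            rw [Finset.card_product, sq]
          exact_mod_cast this
  calc _ ≤ ∑ _Z : Fin k → X with ¬ G _Z,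
        ENNReal.ofReal ((C.card : ℝ) ^ 2 * Real.exp (-(l * a * n / 4))) := by
        gcongr with Z hmem
        exact hZ Z (Finset.mem_filter.1 hmem).2
    _ ≤ ∑ _Z : Fin k → X, ENNReal.ofReal ((C.card : ℝ) ^ 2 * Real.exp (-(l * a * n / 4))) := by
        gcongr
        exact Finset.filter_subset _ _
    _ = _ := by
        rw [Finset.sum_const, Finset.card_univ, Fintype.card_fun, Fintype.card_fin, nsmul_eq_mul,
          ← ENNReal.ofReal_natCast, ← ENNReal.ofReal_mul (by positivity)]
        push_cast
        ring_nf

theorem sum_prod_mul_expMech_labelErrors_le (μ : PMF X) {l a : ℝ} (hl : 0 ≤ l) (hl1 : l ≤ 1)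
    (c : X → Bool) (f : (Fin k → Bool) → X → Bool) {v₀ : Fin k → Bool}
    (hv₀ : genError μ c (f v₀) ≤ a / 8) :
    ∑ y : Fin m → X, (∏ i, μ (y i)) *
        (expMech fun v => l * labelErrors (f v) fun i => (y i, some (c (y i)))).toOuterMeasure
          (f ⁻¹' {h | a < genError μ c h})
      ≤ ENNReal.ofReal (2 ^ k * Real.exp (-(l * a * m / 4))) := by
  simp only [PMF.toOuterMeasure_apply_fintype, labelErrors_eq_boolCount, Finset.mul_sum]
  rw [Finset.sum_comm]
  calc _ ≤ ∑ _v : Fin k → Bool, ENNReal.ofReal (Real.exp (-(l * a * m / 4))) := by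
        gcongr with v
        by_cases hv : a < genError μ c (f v)
        · rw [genError_eq_boolMass] at hv hv₀
          refine le_trans ?_ (μ.sum_prod_exp_boolCount_le hl hl1 hv₀ hv.le m)
          gcongr with y
          refine (Set.indicator_le_self _ _ _).trans ?_
          exact expMech_apply_le _ v v₀
        · simp [Set.indicator, hv]
    _ = _ := by
        rw [Finset.sum_const, Finset.card_univ, Fintype.card_fun, Fintype.card_fin, nsmul_eq_mul,
          ENNReal.ofReal_mul (by positivity), Fintype.card_bool, ← ENNReal.ofReal_natCast]
        push_cast
        rfl

/-- Each stage loses a factor 8: a net of quality `a / 64` exists, the selected one has quality `a /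
8`, and the selected concept has error at most `a`. -/
theorem netLearner_isSSL [Nonempty X] {C : Finset (X → Bool)} {c₀ : X → Bool} (h₀ : c₀ ∈ C) {l a β : ℝ}
    (hl : 0 ≤ l) (hl1 : l ≤ 1) (ha : 0 ≤ a) (hβ : 0 ≤ β)
    (hnet : ∀ p : X → ℝ, (∀ x, 0 ≤ p x) → ∑ x, p x = 1 → ∃ Z : Fin k → X, ∀ c ∈ C, ∀ c' ∈ C,
      (∀ i, c (Z i) = c' (Z i)) → boolMass p (fun x => c x ^^ c' x) ≤ a / 64)
    (hm : 2 ^ k * Real.exp (-(l * a * m / 4)) ≤ β / 2)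
    (hn : (Fintype.card X : ℝ) ^ k * (C.card : ℝ) ^ 2 * Real.exp (-(l * (a / 8) * n / 4)) ≤ β / 2) :
    IsSSL a β m (C : Set (X → Bool)) (netLearner C c₀ k m n l) := by
  classical
  refine ⟨Nat.le_add_right m n, fun c hc μ => ?_⟩
  rw [failureProb, ← Equiv.sum_comp (Fin.appendEquiv m n), Fintype.sum_prod_type]
  obtain ⟨Z₀, hZ₀⟩ := hnet (fun x => (μ x).toReal) (fun x => ENNReal.toReal_nonneg) μ.sum_toReal
  set G : (Fin k → X) → Prop := fun Z => ∀ u ∈ agreePairs C Z,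
    boolMass (fun x => (μ x).toReal) (fun x => u.1 x ^^ u.2 x) ≤ a / 8 with hG
  have key := sum_sum_two_stage_le (μ.sum_prod_apply m) (μ.sum_prod_apply n)
    (P := fun z Z => expMech (fun Z : Fin k → X => l * netScore C z Z) Z)
    (Q := fun y Z => (expMech fun v : Fin k → Bool => l * labelErrors (concept C c₀ Z v)
      fun i => (y i, some (c (y i)))).toOuterMeasure
        (concept C c₀ Z ⁻¹' {h | a < genError μ c h}))
    (fun z => by rw [← tsum_fintype (L := .unconditional _), PMF.tsum_coe])
    (fun y Z => PMF.toOuterMeasure_le_one _ _) G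
    (a := ENNReal.ofReal (β / 2)) (b := ENNReal.ofReal (β / 2)) ?_ ?_
  · rw [← ENNReal.ofReal_add (by positivity) (by positivity), add_halves] at key
    refine le_trans (le_of_eq ?_) key
    refine Finset.sum_congr rfl fun y _ => Finset.sum_congr rfl fun z _ => ?_
    rw [show Fin.appendEquiv m n (y, z) = Fin.append y z from rfl, Fin.prod_univ_add]
    simp only [Fin.append_left, Fin.append_right]
    congr 1
    rw [netLearner, PMF.toOuterMeasure_bind_apply, tsum_fintype]
    simp only [PMF.toOuterMeasure_map_apply, labelFirst, Fin.append_left, Fin.append_right,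
      Fin.val_castAdd, Fin.is_lt, if_true]
  · refine le_trans (sum_prod_mul_expMech_netScore_le ⟨c₀, h₀⟩ μ hl hl1 (a := a / 8) (Z₀ := Z₀)
      (fun u hu => ?_) G fun Z hZ => ?_) (ENNReal.ofReal_le_ofReal hn)
    · simp only [agreePairs, Finset.mem_filter, Finset.mem_product] at hu
      exact (hZ₀ _ hu.1.1 _ hu.1.2 hu.2).trans (by linarith [ha])
    · simp only [hG] at hZ
      push Not at hZ
      obtain ⟨u, hu, h⟩ := hZ
      exact ⟨u, hu, h.le⟩
  · intro Z hZ
    refine le_trans (sum_prod_mul_expMech_labelErrors_le μ hl hl1 c (concept C c₀ Z)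
      (v₀ := fun i => c (Z i)) ?_) (ENNReal.ofReal_le_ofReal hm)
    rw [genError_eq_boolMass]
    -- The competitor in the second stage is the representative of the target's own pattern on `Z`.
    refine hZ (concept C c₀ Z fun i => c (Z i), c) ?_
    simp only [agreePairs, Finset.mem_filter, Finset.mem_product]
    exact ⟨⟨concept_mem h₀ _ _, hc⟩, fun i => concept_apply c₀ Z hc i⟩

end Accuracy

/-! ### Choice of parameters and sample sizes. -/

/-- A uniform guess hits the target with probability `1 / |C|`. This serves the degenerate cases,
where the bound on the sample size may force it to be 0. -/
theorem exists_uniform_learner {X : Type*} [Fintype X] {C : Finset (X → Bool)} (hC : C.Nonempty)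
    {α β : ℝ} (ε : ℝ) (hα : 0 < α) (hβ : 1 - 1 / (C.card : ℝ) ≤ β) :
    ∃ A : LearningAlgorithm X 0, IsPSSL α β ε 0 0 (C : Set (X → Bool)) A ∧
      IsProperLearner (C : Set (X → Bool)) A := by
  classical
  refine ⟨fun _ => PMF.uniformOfFinset C hC, ⟨⟨le_rfl, fun c hc μ => ?_⟩, fun D D' h => ?_⟩,
    fun D h hh => by simpa using hh⟩
  · have h1 : (C.filter fun h => h ∈ {h | α < genError μ c h}).card ≤ C.card - 1 := by
      rw [← Finset.card_erase_of_mem hc]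
      refine Finset.card_le_card fun h hh => ?_
      simp only [Finset.mem_filter, Set.mem_ofPred_eq] at hh
      refine Finset.mem_erase.2 ⟨?_, hh.1⟩
      rintro rfl
      have := hh.2
      simp [genError] at this
      linarith
    have hpos : (0 : ℝ) < C.card := by exact_mod_cast hC.card_pos
    rw [failureProb, Fintype.sum_unique]
    simp only [Finset.univ_eq_empty, Finset.prod_empty, one_mul,
      PMF.toOuterMeasure_uniformOfFinset_apply]
    refine le_trans ?_ (ENNReal.ofReal_le_ofReal hβ)
    rw [← ENNReal.ofReal_natCast, ← ENNReal.ofReal_natCast, ← ENNReal.ofReal_div_of_pos hpos]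
    apply ENNReal.ofReal_le_ofReal
    rw [one_sub_div hpos.ne']
    gcongr
    rw [← Nat.cast_one, ← Nat.cast_sub hC.card_pos]
    exact_mod_cast h1
  · exact h.exists.choose.elim0

theorem exists_netLearner {X : Type*} [Fintype X] [Nonempty X] {C : Finset (X → Bool)}
    (hC : C.Nonempty) {k : ℕ} {l α β ε : ℝ} (hl : 0 < l) (hl1 : l ≤ 1) (hlε : 4 * l ≤ ε)
    (hα : 0 < α) (hβ : 0 < β) (hβ1 : β < 1)
    (hnet : ∀ p : X → ℝ, (∀ x, 0 ≤ p x) → ∑ x, p x = 1 → ∃ Z : Fin k → X, ∀ c ∈ C, ∀ c' ∈ C,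
      (∀ i, c (Z i) = c' (Z i)) → boolMass p (fun x => c x ^^ c' x) ≤ α / 64) :
    ∃ (n m : ℕ) (A : LearningAlgorithm X n), IsPSSL α β ε 0 m (C : Set (X → Bool)) A ∧
      IsProperLearner (C : Set (X → Bool)) A ∧
      (m : ℝ) ≤ 4 / (l * α) * (k + 1 + Real.log (1 / β)) + 1 ∧
      (n : ℝ) ≤ m + (32 / (l * α) * (k * Real.log (Fintype.card X) + 2 * Real.log C.card + 1
        + Real.log (1 / β)) + 1) := by
  obtain ⟨c₀, h₀⟩ := id hC
  have hlog : 0 ≤ Real.log (1 / β) := Real.log_nonneg (by rw [le_div_iff₀ hβ]; linarith)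
  -- The summand 1 pays for halving `β`, as `exp (-1) ≤ 1 / 2`.
  have hexp : Real.exp (-(1 + Real.log (1 / β))) ≤ β / 2 := by
    rw [neg_add, Real.exp_add, one_div, Real.log_inv, neg_neg, Real.exp_log hβ]
    have h1 : Real.exp (-1) * Real.exp 1 = 1 := by rw [← Real.exp_add]; simp
    have h2 := Real.add_one_le_exp 1
    have h3 := Real.exp_pos (-1)
    nlinarith
  have hX : (1 : ℝ) ≤ Fintype.card X := by exact_mod_cast Fintype.card_pos
  have hCc : (1 : ℝ) ≤ C.card := by exact_mod_cast hC.card_pos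
  have hk2 : (2 : ℝ) ^ k ≤ Real.exp k := by
    rw [← mul_one (k : ℝ), Real.exp_nat_mul]
    gcongr
    linarith [Real.add_one_le_exp 1]
  have hXk : (Fintype.card X : ℝ) ^ k = Real.exp (k * Real.log (Fintype.card X)) := by
    rw [Real.exp_nat_mul, Real.exp_log (by linarith)]
  have hC2 : (C.card : ℝ) ^ 2 = Real.exp (2 * Real.log C.card) := by
    have := Real.exp_nat_mul (Real.log C.card) 2
    rw [Real.exp_log (by linarith)] at this
    rw [← this]
    norm_num
  set s : ℝ := 4 / (l * α) * (k + 1 + Real.log (1 / β)) with hs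
  set t : ℝ := 32 / (l * α) * (k * Real.log (Fintype.card X) + 2 * Real.log C.card + 1
        + Real.log (1 / β)) with ht
  have hs0 : 0 ≤ s := by positivity
  have ht0 : 0 ≤ t := by
    have := Real.log_nonneg hX
    have := Real.log_nonneg hCc
    positivity
  have hsm : l * α * s / 4 = k + 1 + Real.log (1 / β) := by
    rw [hs]
    field_simp
  have htn : l * (α / 8) * t / 4 = k * Real.log (Fintype.card X) + 2 * Real.log C.card + 1
        + Real.log (1 / β) := by
    rw [ht]
    field_simp
    norm_num
  have hm : l * α * s / 4 ≤ l * α * ⌈s⌉₊ / 4 := by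
    gcongr
    exact Nat.le_ceil s
  have hn : l * (α / 8) * t / 4 ≤ l * (α / 8) * ⌈t⌉₊ / 4 := by
    gcongr
    exact Nat.le_ceil t
  refine ⟨⌈s⌉₊ + ⌈t⌉₊, ⌈s⌉₊, netLearner C c₀ k ⌈s⌉₊ ⌈t⌉₊ l,
    ⟨netLearner_isSSL h₀ hl.le hl1 hα.le hβ.le hnet ?_ ?_,
      netLearner_isDifferentiallyPrivate C c₀ hl.le hlε⟩,
    netLearner_isProperLearner h₀ l, (Nat.ceil_lt_add_one hs0).le, ?_⟩
  · calc _ ≤ Real.exp k * Real.exp (-(l * α * ⌈s⌉₊ / 4)) := by gcongr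
      _ ≤ Real.exp (-(1 + Real.log (1 / β))) := by
        rw [← Real.exp_add]
        gcongr
        linarith
      _ ≤ _ := hexp
  · rw [hXk, hC2, ← Real.exp_add, ← Real.exp_add]
    refine le_trans ?_ hexp
    gcongr
    linarith
  · push_cast
    gcongr
    exact (Nat.ceil_lt_add_one ht0).le

/-- With `x = a / 32`, the trace count on `2 * k` points is at most `exp (k * a / 16 + 32 * V / a)`.
The crude bound `1 / x ≤ exp (1 / x)` makes `k` of order `V / a ^ 2`, which the cubic power of `α`
in the theorem allows. -/
theorem exists_net_of_vcDim {X : Type*} [Fintype X] [DecidableEq X] {C : Finset (X → Bool)}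
    {V k : ℕ} (hV : conceptVCDim (C : Set (X → Bool)) = V) (hV1 : 1 ≤ V) {a : ℝ} (ha : 0 < a)
    (ha1 : a ≤ 1) (hk : 1024 * V / a ^ 2 ≤ k) {p : X → ℝ} (hp : ∀ x, 0 ≤ p x)
    (hp1 : ∑ x, p x = 1) :
    ∃ Z : Fin k → X, ∀ c ∈ C, ∀ c' ∈ C, (∀ i, c (Z i) = c' (Z i)) →
      boolMass p (fun x => c x ^^ c' x) ≤ a := by
  refine exists_net C hp hp1 ha.le (P := Real.exp (k * a / 16 + 32 * V / a)) (fun w => ?_) ?_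
  · refine (card_image_comp_le C w (x := a / 32) (by positivity) (by linarith)).trans ?_
    rw [hV, Fintype.card_prod, Fintype.card_fin, Fintype.card_bool, Real.exp_add, div_eq_mul_inv,
      ← inv_pow]
    gcongr ?_ * ?_
    · rw [show (k : ℝ) * a / 16 = (k * 2 : ℕ) * (a / 32) by push_cast; ring, Real.exp_nat_mul]
      gcongr
      linarith [Real.add_one_le_exp (a / 32)]
    · rw [show 32 * (V : ℝ) / a = V * (a / 32)⁻¹ by field_simp, Real.exp_nat_mul]
      gcongr
      linarith [Real.add_one_le_exp (a / 32)⁻¹]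
  · have h1 : Real.exp (a / 2) ≤ 1 + a := by
      have h1 : Real.exp (-(a / 2)) * Real.exp (a / 2) = 1 := by rw [← Real.exp_add]; simp
      have h2 := Real.add_one_le_exp (-(a / 2))
      have h3 := Real.exp_pos (a / 2)
      have h4 : (1 - a / 2) * Real.exp (a / 2) ≤ 1 := by nlinarith
      have h5 : 1 ≤ (1 - a / 2) * (1 + a) := by nlinarith
      exact le_of_mul_le_mul_left (h4.trans h5) (by linarith)
    have hV0 : (1 : ℝ) ≤ V := by exact_mod_cast hV1
    rw [div_le_iff₀ (by positivity)] at hk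
    have hVa : 64 * V / a ≤ k * a / 16 := by
      rw [div_le_iff₀ ha]
      nlinarith
    have hpos : 0 < 64 * V / a := by positivity
    calc Real.exp (k * a / 16 + 32 * V / a) ^ 2
        = Real.exp (k * a / 8 + 64 * V / a) := by
          rw [← Real.exp_nat_mul]
          congr 1
          push_cast
          ring
      _ < Real.exp (k * (a / 2)) := by
          apply Real.exp_lt_exp.2
          linarith
      _ = Real.exp (a / 2) ^ k := Real.exp_nat_mul _ _
      _ ≤ (1 + a) ^ k := by gcongr

/-- Sauer with `x = 2 ^ (-d)` on all `2 ^ d` points: `(1 + x) ^ (2 ^ d) ≤ exp 1`, and `x ^ (-V) = 2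
^ (d * V)`. -/
theorem log_card_le {d : ℕ} {C : Finset (Cube d → Bool)} (hC : C.Nonempty) :
    Real.log C.card ≤ 1 + d * conceptVCDim (C : Set (Cube d → Bool)) := by
  have h := card_image_comp_le C (id : Cube d → Cube d) (x := (2 ^ d)⁻¹) (by positivity)
    (inv_le_one_of_one_le₀ (one_le_pow₀ one_le_two))
  have hpos : (0 : ℝ) < C.card := by exact_mod_cast hC.card_pos
  simp only [Function.comp_id, Finset.image_id', Fintype.card_fun, Fintype.card_bool,
    Fintype.card_fin] at h
  rw [Real.log_le_iff_le_exp hpos]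
  refine h.trans ?_
  rw [inv_pow _ (conceptVCDim _), div_inv_eq_mul, ← pow_mul, Real.exp_add]
  gcongr ?_ * ?_
  · calc (1 + ((2 : ℝ) ^ d)⁻¹) ^ 2 ^ d ≤ Real.exp ((2 ^ d)⁻¹) ^ 2 ^ d := by
          gcongr
          linarith [Real.add_one_le_exp ((2 : ℝ) ^ d)⁻¹]
      _ = Real.exp 1 := by
          rw [← Real.exp_nat_mul]
          congr 1
          push_cast
          exact mul_inv_cancel₀ (by positivity)
  · rw [← Nat.cast_mul, ← mul_one ((d * _ : ℕ) : ℝ), Real.exp_nat_mul]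
    gcongr
    linarith [Real.add_one_le_exp 1]

theorem card_le_one_of_vcDim_eq_zero {X : Type*} [Fintype X] [DecidableEq X]
    {C : Finset (X → Bool)} (h : conceptVCDim (C : Set (X → Bool)) = 0) : C.card ≤ 1 := by
  have h0 : Finset.Iic 0 = {0} := rfl
  simpa [h, h0] using card_le_sum_choose C

theorem exists_learner_of_pos {d : ℕ} (hd : 1 ≤ d) {C : Finset (Cube d → Bool)} (hC : C.Nonempty)
    {V : ℕ} (hV : conceptVCDim (C : Set (Cube d → Bool)) = V) (hV1 : 1 ≤ V)
    {E α β ε : ℝ} (hE : 1 ≤ E) (hα : 0 < α) (hα1 : α ≤ 1) (hβ : 0 < β) (hβ1 : β < 1) (hε : 0 < ε)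
    (hεE : ε ≤ E) :
    ∃ (n m : ℕ) (A : LearningAlgorithm (Cube d) n),
      IsPSSL α β ε 0 m (C : Set (Cube d → Bool)) A ∧
      IsProperLearner (C : Set (Cube d → Bool)) A ∧
      (m : ℝ) ≤ 10 ^ 9 * E * (V / (α ^ 3 * ε) + 1 / (α * ε) * Real.log (1 / β)) ∧
      (n : ℝ) ≤ 10 ^ 9 * E * (d * V / (α ^ 3 * ε) + 1 / (α * ε) * Real.log (1 / β)) := by
  have hE0 : 0 < E := by linarith
  -- Dividing by `E ≥ max 1 ε` ensures both `l ≤ 1` and `4 * l ≤ ε`. Below, `r ≥ 1` and `q ≥ V ≥ 1`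
  -- absorb the roundings and additive constants.
  obtain ⟨n, m, A, hA, hA', hm, hn⟩ := exists_netLearner hC
    (k := ⌈1024 * (V : ℝ) / (α / 64) ^ 2⌉₊) (l := ε / (4 * E)) (α := α) (β := β) (ε := ε)
    (by positivity) (by rw [div_le_one (by positivity)]; linarith)
    (by
      rw [← mul_div_assoc, mul_div_mul_left _ _ (by norm_num)]
      exact div_le_self hε.le hE) hα hβ hβ1
    fun p hp hp1 => exists_net_of_vcDim hV hV1 (by positivity) (by linarith) (Nat.le_ceil _) hp hp1
  have hlogC := log_card_le hC
  rw [hV] at hlogC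
  have hV0 : (1 : ℝ) ≤ V := by exact_mod_cast hV1
  have hd0 : (1 : ℝ) ≤ d := by exact_mod_cast hd
  set k : ℝ := (⌈1024 * (V : ℝ) / (α / 64) ^ 2⌉₊ : ℝ) with hk
  set b := Real.log (1 / β) with hb
  have hb0 : 0 ≤ b := Real.log_nonneg (by rw [le_div_iff₀ hβ]; linarith)
  set q : ℝ := V / α ^ 2 with hq
  have hVq : V ≤ q := by
    rw [hq, le_div_iff₀ (by positivity)]
    exact mul_le_of_le_one_right (by positivity) (pow_le_one₀ hα.le hα1)
  have hkq : k ≤ 4194305 * q := by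
    have h1 : 1024 * (V : ℝ) / (α / 64) ^ 2 = 4194304 * q := by
      rw [hq]
      field_simp
      norm_num
    have h2 := (Nat.ceil_lt_add_one (a := 1024 * (V : ℝ) / (α / 64) ^ 2) (by positivity)).le
    rw [← hk] at h2
    linarith
  have hlogX : k * Real.log (Fintype.card (Cube d)) ≤ 4194305 * (d * q) := by
    have h1 : Real.log (Fintype.card (Cube d)) ≤ d := by
      simp only [Fintype.card_fun, Fintype.card_bool, Fintype.card_fin]
      push_cast
      rw [Real.log_pow]
      have := Real.log_two_lt_d9
      exact mul_le_of_le_one_right (by positivity) (by linarith)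
    calc k * Real.log (Fintype.card (Cube d)) ≤ k * d := by gcongr
      _ ≤ 4194305 * q * d := by gcongr
      _ = _ := by ring
  have hdV : d * (V : ℝ) ≤ d * q := by gcongr
  have hdq : q ≤ d * q := le_mul_of_one_le_left (by linarith) hd0
  set r : ℝ := E / (α * ε) with hr
  have hr1 : 1 ≤ r := by
    rw [hr, le_div_iff₀ (by positivity)]
    nlinarith
  have e1 : 4 / (ε / (4 * E) * α) = 16 * r := by
    rw [hr]
    field_simp
    norm_num
  have e2 : 32 / (ε / (4 * E) * α) = 128 * r := by
    rw [hr]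
    field_simp
    norm_num
  have e3 : 10 ^ 9 * E * (V / (α ^ 3 * ε) + 1 / (α * ε) * b) = 10 ^ 9 * (r * (q + b)) := by
    rw [hr, hq]
    field_simp
  have e4 : 10 ^ 9 * E * (d * V / (α ^ 3 * ε) + 1 / (α * ε) * b)
      = 10 ^ 9 * (r * (d * q + b)) := by
    rw [hr, hq]
    field_simp
  rw [e1] at hm
  rw [e2] at hn
  have hm' : (m : ℝ) ≤ r * (16 * (4194305 * q + 1 + b) + 1) := by
    have : r * (k + 1 + b) ≤ r * (4194305 * q + 1 + b) := by gcongr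
    linarith
  have hn' : (n : ℝ) ≤ m + r * (128 * (4194305 * (d * q) + 2 * (1 + d * q) + 1 + b) + 1) := by
    have : r * (k * Real.log (Fintype.card (Cube d)) + 2 * Real.log C.card + 1 + b)
        ≤ r * (4194305 * (d * q) + 2 * (1 + d * q) + 1 + b) := by
      gcongr
      linarith
    linarith
  refine ⟨n, m, A, hA, hA', ?_, ?_⟩
  · rw [e3, mul_left_comm]
    refine hm'.trans ?_
    gcongr
    linarith
  · rw [e4, mul_left_comm]
    calc (n : ℝ) ≤ r * (16 * (4194305 * q + 1 + b) + 1 +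
          (128 * (4194305 * (d * q) + 2 * (1 + d * q) + 1 + b) + 1)) := by linarith
      _ ≤ _ := by
        gcongr
        linarith

/-- For `d = 0` only `log (1 / β)` bounds the sample. It absorbs additive constants when `β < 1 /
2`; otherwise guessing among at most two concepts suffices. -/
theorem exists_learner_of_zero {C : Finset (Cube 0 → Bool)} (hC : C.Nonempty)
    {E α β ε : ℝ} (hE : 1 ≤ E) (hα : 0 < α) (hα1 : α ≤ 1) (hβ : 0 < β) (hβ1 : β < 1) (hε : 0 < ε)
    (hεE : ε ≤ E) :
    ∃ (n m : ℕ) (A : LearningAlgorithm (Cube 0) n),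
      IsPSSL α β ε 0 m (C : Set (Cube 0 → Bool)) A ∧
      IsProperLearner (C : Set (Cube 0 → Bool)) A ∧
      (m : ℝ) ≤ 10 ^ 9 * E * (1 / (α * ε) * Real.log (1 / β)) ∧
      (n : ℝ) ≤ 10 ^ 9 * E * (1 / (α * ε) * Real.log (1 / β)) := by
  have hE0 : 0 < E := by linarith
  set b := Real.log (1 / β) with hb
  have hb0 : 0 ≤ b := Real.log_nonneg (by rw [le_div_iff₀ hβ]; linarith)
  rcases le_or_gt (1 / 2) β with h | h
  · have hcard : (C.card : ℝ) ≤ 2 := by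
      have := Finset.card_le_univ C
      simp only [Fintype.card_fun, Fintype.card_bool, Fintype.card_fin, pow_zero, pow_one] at this
      exact_mod_cast this
    have hpos : (0 : ℝ) < C.card := by exact_mod_cast hC.card_pos
    obtain ⟨A, hA, hA'⟩ := exists_uniform_learner hC (β := β) ε hα (by
      have : 1 / (2 : ℝ) ≤ 1 / C.card := by gcongr
      linarith)
    refine ⟨0, 0, A, hA, hA', ?_, ?_⟩ <;> · push_cast; positivity
  · obtain ⟨n, m, A, hA, hA', hm, hn⟩ := exists_netLearner hC
      -- The domain is a single point, which is itself a perfect net.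
      (k := 1) (l := ε / (4 * E)) (α := α) (β := β) (ε := ε)
      (by positivity) (by rw [div_le_one (by positivity)]; linarith)
      (by
        rw [← mul_div_assoc, mul_div_mul_left _ _ (by norm_num)]
        exact div_le_self hε.le hE) hα hβ hβ1
      (fun p _ _ => ⟨fun _ => default, fun c _ c' _ hcc => by
        have : ∀ x, (c x ^^ c' x) = false := fun x => by
          rw [Subsingleton.elim x default, hcc 0]
          simp
        simp only [boolMass, this]
        simpa using by positivity⟩)
    have hlogC := log_card_le hC
    have hb1 : 1 / 2 ≤ b := by
      have h2 : Real.log 2 ≤ b := Real.log_le_log (by norm_num) (by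
        rw [le_div_iff₀ hβ]
        linarith)
      linarith [Real.log_two_gt_d9]
    set r : ℝ := E / (α * ε) with hr
    have hr1 : 1 ≤ r := by
      rw [hr, le_div_iff₀ (by positivity)]
      nlinarith
    have e1 : 4 / (ε / (4 * E) * α) = 16 * r := by
      rw [hr]
      field_simp
      norm_num
    have e2 : 32 / (ε / (4 * E) * α) = 128 * r := by
      rw [hr]
      field_simp
      norm_num
    have e3 : 10 ^ 9 * E * (1 / (α * ε) * b) = 10 ^ 9 * (r * b) := by
      rw [hr]
      field_simp
    rw [e1] at hm
    rw [e2] at hn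
    rw [e3]
    simp only [Fintype.card_fun, Fintype.card_bool, Fintype.card_fin, pow_zero, Nat.cast_one,
      Real.log_one, mul_zero, zero_add, zero_mul, add_zero, CharP.cast_eq_zero] at hn hlogC hm
    have hrb : r ≤ 2 * (r * b) := by nlinarith
    have hrC : r * Real.log C.card ≤ r := mul_le_of_le_one_right (by linarith) hlogC
    refine ⟨n, m, A, hA, hA', ?_, ?_⟩ <;> linarith

/-! ### Assembly of the cases. -/

theorem mainTheorem1 (α₀ ε₀ : ℝ) (hα₀ : α₀ < 1) :
    ∃ K : ℝ, ∀ (d : ℕ) (C : Set (Cube d → Bool)), C.Nonempty →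
      ∀ α β ε : ℝ, 0 < α → α ≤ α₀ → 0 < β → β < 1 → 0 < ε → ε ≤ ε₀ →
        ∃ (n m : ℕ) (A : LearningAlgorithm (Cube d) n),
          IsPSSL α β ε 0 m C A ∧ IsProperLearner C A ∧
          (m : ℝ) ≤ K * ((conceptVCDim C : ℝ) / (α ^ 3 * ε) * Real.log (1 / α)
            + 1 / (α * ε) * Real.log (1 / β)) ∧
          (n : ℝ) ≤ K * ((d : ℝ) * (conceptVCDim C : ℝ) / (α ^ 3 * ε) * Real.log (1 / α)
            + 1 / (α * ε) * Real.log (1 / β)) := by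
  set L₀ : ℝ := Real.log (1 / α₀) with hL₀
  refine ⟨10 ^ 9 * (1 + |ε₀|) * (1 + 1 / L₀), fun d C hC α β ε hα hαα₀ hβ hβ1 hε hεε₀ => ?_⟩
  obtain ⟨C, rfl⟩ : ∃ C' : Finset (Cube d → Bool), (C' : Set (Cube d → Bool)) = C :=
    ⟨C.toFinite.toFinset, by simp⟩
  replace hC : C.Nonempty := by simpa using hC
  have hα₀0 : 0 < α₀ := hα.trans_le hαα₀
  have hL₀0 : 0 < L₀ := Real.log_pos (by rwa [lt_div_iff₀ hα₀0, one_mul])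
  have hL : L₀ ≤ Real.log (1 / α) := Real.log_le_log (by positivity) (by gcongr)
  set L := Real.log (1 / α) with hLdef
  set b := Real.log (1 / β) with hb
  have hL0 : 0 < L := hL₀0.trans_le hL
  have hb0 : 0 ≤ b := Real.log_nonneg (by rw [le_div_iff₀ hβ]; linarith)
  set E : ℝ := 1 + |ε₀| with hE
  have hE1 : 1 ≤ E := by linarith [abs_nonneg ε₀]
  have hE0 : 0 < E := by linarith
  have hεE : ε ≤ E := by linarith [le_abs_self ε₀]
  have hα1 : α ≤ 1 := by linarith
  -- The estimates so far lack the factor `log (1 / α)`. It is at least `L₀ > 0`, so inserting it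
  -- costs only a constant; this is where `α₀ < 1` matters.
  have hle : ∀ x w : ℝ, 0 ≤ x → 0 ≤ w →
      10 ^ 9 * E * (x + w) ≤ 10 ^ 9 * E * (1 + 1 / L₀) * (x * L + w) := by
    intro x w hx hw
    rw [mul_assoc (10 ^ 9 * E)]
    gcongr
    have h1 : 1 ≤ 1 / L₀ * L := by rwa [one_div_mul_eq_div, one_le_div hL₀0]
    have h2 : 0 ≤ 1 / L₀ * w := by positivity
    have h3 : 0 ≤ x * L := by positivity
    nlinarith
  have hw : 0 ≤ 1 / (α * ε) * b := by positivity
  obtain ⟨V, hV⟩ : ∃ V, conceptVCDim (C : Set (Cube d → Bool)) = V := ⟨_, rfl⟩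
  rw [hV]
  rcases Nat.eq_zero_or_pos V with rfl | hV1
  · have hcard : C.card = 1 := le_antisymm (card_le_one_of_vcDim_eq_zero hV) hC.card_pos
    obtain ⟨A, hA, hA'⟩ := exists_uniform_learner hC (β := β) ε hα (by simp [hcard, hβ.le])
    refine ⟨0, 0, A, hA, hA', ?_, ?_⟩ <;> · push_cast; positivity
  · rcases Nat.eq_zero_or_pos d with rfl | hd
    · obtain ⟨n, m, A, hA, hA', hm, hn⟩ := exists_learner_of_zero hC hE1 hα hα1 hβ hβ1 hε hεE
      have h0 := hle 0 _ le_rfl hw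
      have h1 : 10 ^ 9 * E * (1 / (α * ε) * b)
          ≤ 10 ^ 9 * E * (0 + 1 / (α * ε) * b) := by rw [zero_add]
      refine ⟨n, m, A, hA, hA', hm.trans ?_, hn.trans ?_⟩
      · refine h1.trans (h0.trans ?_)
        gcongr
        positivity
      · refine h1.trans (h0.trans ?_)
        gcongr
        simp
    · obtain ⟨n, m, A, hA, hA', hm, hn⟩ :=
        exists_learner_of_pos hd hC hV hV1 hE1 hα hα1 hβ hβ1 hε hεE
      exact ⟨n, m, A, hA, hA', hm.trans (hle _ _ (by positivity) hw),
        hn.trans (hle _ _ (by positivity) hw)⟩
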